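/- Let $d\ge 3$ and $m\ge 1$ be integers, let $X=\{0,\dots,d-1\}$, with addition of letters taken modulo $d$, and let $T_d$ be the rooted $d$-ary tree whose vertices are the finite words in $X$. Let $a\in\mathrm{Aut}(T_d)$ be given by $a(v_0v_1\dots v_n)=(v_0+1)v_1\dots v_n$, put $A=\langle a\rangle\cong\mathbb Z/d\mathbb Z$ and $B=(\mathbb Z/d\mathbb Z)^m$, and let $\omega=(\omega_n)_{n\ge 0}$ be a sequence of epimorphisms $\omega_n:B\to A$ such that $\bigcap_{j\ge i}\ker\omega_j$ is trivial for every $i\ge 0$. For $b\in B$ let $b_\omega\in\mathrm{Aut}(T_d)$ be the automorphism with $$b_\omega\big((d-1)^r\,0\,v_{r+1}v_{r+2}\dots v_n\big)=(d-1)^r\,0\,\omega_r(b)(v_{r+1})\,v_{r+2}\dots v_n\qquad(0\le r<n)$$ which fixes all other words. Put $B_\omega=\langle b_\omega\mid b\in B\rangle$, and let $G_\omega=\langle A,B_\omega\rangle$ be the corresponding spinal group, with generating set $S_\omega=(A\cup B_\omega)\setminus\{1\}$, acting on the boundary $X^{\mathbb N}$ of $T_d$. For $\xi\in X^{\mathbb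 N}$ let $\Gamma_\xi$ be the Schreier graph of the orbit $G_\omega\cdot\xi$ with respect to $S_\omega$, considered as an undirected, unlabeled multigraph: its vertices are the points of the orbit, and for every vertex $v$ and every $s\in S_\omega$ there is one edge with ends $v$ and $sv$ (a loop if $sv=v$). Then every rooted, unlabeled isomorphism class has measure zero: for every $\xi\in X^{\mathbb N}$, the set of all $\eta\in X^{\mathbb N}$ for which $(\Gamma_\xi,\xi)$ and $(\Gamma_\eta,\eta)$ are isomorphic as rooted, undirected, unlabeled multigraphs has measure zero for the Bernoulli measure on $X^{\mathbb N}$, that is, the product of the uniform probability measures on $X$. -/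

import Mathlib

/-! ### Automorphisms of the rooted tree of words and the action on its boundary -/

/-- The group `Aut(T)` of automorphisms of the rooted regular tree `T` whose vertices are the finite
words in the alphabet `X`: the bijections of the set of words that preserve the levels (the length
of words) and the prefix order. -/
def TreeAut (X : Type*) : Subgroup (Equiv.Perm (List X)) where
  carrier := {g | (∀ v, (g v).length = v.length) ∧ ∀ u v, u <+: v → g u <+: g v}
  one_mem' := ⟨fun _ => rfl, fun _ _ h => h⟩
  mul_mem' := by
    rintro g h ⟨hg, hg'⟩ ⟨hh, hh'⟩
    exact ⟨fun v => by simp [hg, hh], fun u v huv => hg' _ _ (hh' _ _ huv)⟩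
  inv_mem' := by
    rintro g ⟨hg, hg'⟩
    have hl : ∀ v, (g⁻¹ v).length = v.length := fun v => by
      conv_rhs => rw [← Equiv.apply_symm_apply g v]
      exact (hg _).symm
    refine ⟨hl, fun u v huv => ?_⟩
    have h1 : g ((g⁻¹ v).take u.length) <+: v := by
      have := hg' _ _ (List.take_prefix u.length (g⁻¹ v))
      rwa [show g (g⁻¹ v) = v from Equiv.apply_symm_apply g v] at this
    have h2 : g ((g⁻¹ v).take u.length) = u := by
      apply List.IsPrefix.eq_of_length (List.prefix_of_prefix_length_le h1 huv _)
      · rw [hg, List.length_take, hl]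
        exact min_eq_left huv.length_le
      · rw [hg, List.length_take, hl]
        exact min_le_left _ _
    have h3 : g⁻¹ u = (g⁻¹ v).take u.length := by
      rw [Equiv.Perm.inv_eq_iff_eq]
      exact h2.symm
    rw [h3]
    exact List.take_prefix _ _

/-- The prefix of length `n` of an infinite word `ξ`. -/
def wordPrefix {X : Type*} (ξ : ℕ → X) (n : ℕ) : List X := (List.range n).map ξ

theorem wordPrefix_length {X : Type*} (ξ : ℕ → X) (n : ℕ) : (wordPrefix ξ n).length = n := by
  simp [wordPrefix]

theorem wordPrefix_prefix {X : Type*} (ξ : ℕ → X) {k n : ℕ} (h : k ≤ n) :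
    wordPrefix ξ k <+: wordPrefix ξ n := by
  obtain ⟨j, rfl⟩ := Nat.exists_eq_add_of_le h
  simp [wordPrefix, List.range_add]

/-- The image of the boundary point `ξ` under the tree automorphism `g`. -/
def boundaryMap {X : Type*} (g : TreeAut X) (ξ : ℕ → X) : ℕ → X := fun n =>
  (g.1 (wordPrefix ξ (n + 1)))[n]'(by rw [g.2.1, wordPrefix_length]; exact n.lt_succ_self)

/-- The `n`-prefix of `g ξ` is the image under `g` of the `n`-prefix of `ξ`. -/
theorem wordPrefix_boundaryMap {X : Type*} (g : TreeAut X) (ξ : ℕ → X) (n : ℕ) :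
    wordPrefix (boundaryMap g ξ) n = g.1 (wordPrefix ξ n) := by
  apply List.ext_getElem
  · rw [g.2.1, wordPrefix_length, wordPrefix_length]
  · intro i h1 h2
    have hi : i < n := by rwa [wordPrefix_length] at h1
    have := g.2.2 _ _ (wordPrefix_prefix ξ (Nat.succ_le_of_lt hi))
    simp only [wordPrefix, List.getElem_map, List.getElem_range]
    exact this.getElem _

theorem wordPrefix_injective {X : Type*} {ξ η : ℕ → X}
    (h : ∀ n, wordPrefix ξ n = wordPrefix η n) : ξ = η := by
  funext n
  have := h (n + 1)
  simp only [wordPrefix, List.map_inj_left, List.mem_range] at this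
  exact this n n.lt_succ_self

/-- The action of `Aut(T)` on the boundary `X^ℕ` of the tree. -/
instance TreeAut.boundaryAction {X : Type*} : MulAction (TreeAut X) (ℕ → X) where
  smul := boundaryMap
  one_smul ξ := wordPrefix_injective fun n => wordPrefix_boundaryMap 1 ξ n
  mul_smul g h ξ := wordPrefix_injective fun n => by
    refine (wordPrefix_boundaryMap (g * h) ξ n).trans ?_
    refine Eq.trans ?_ (wordPrefix_boundaryMap g (boundaryMap h ξ) n).symm
    rw [wordPrefix_boundaryMap]
    rfl

/-! ### Spinal groups

The alphabet `X = {0, …, d - 1}`, with addition modulo `d`, is `ZMod d`, so that the letter `d - 1`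
is `-1`. The cyclic group `A` of order `d` generated by the rotation `a` is identified with `ℤ/dℤ`
by `a ^ j ↦ j` wherever epimorphisms `B → A` are concerned, with `B = (ℤ/dℤ)^m`. -/

/-- Add `j` to the first letter of a word. -/
def rotateWord {d : ℕ} (j : ZMod d) : List (ZMod d) → List (ZMod d)
  | [] => []
  | x :: v => (x + j) :: v

/-- For a sequence `c = c_0 c_1 …` in `ℤ/dℤ`, the map that adds `c_r` to the letter following the
prefix `(d-1)^r 0`, for every `r`, and fixes all other words. -/
def spinalWord {d : ℕ} : (ℕ → ZMod d) → List (ZMod d) → List (ZMod d)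
  | _, [] => []
  | c, x :: v =>
    if x = 0 then x :: rotateWord (c 0) v
    else if x = -1 then x :: spinalWord (fun n => c (n + 1)) v
    else x :: v

theorem rotateWord_length {d : ℕ} (j : ZMod d) (v : List (ZMod d)) :
    (rotateWord j v).length = v.length := by
  cases v <;> simp [rotateWord]

theorem rotateWord_prefix {d : ℕ} (j : ZMod d) {u v : List (ZMod d)} (h : u <+: v) :
    rotateWord j u <+: rotateWord j v := by
  cases u with
  | nil => simp [rotateWord]
  | cons x u =>
    cases v with
    | nil => simp at h
    | cons y v =>
      rw [List.cons_prefix_cons] at h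
      simp [rotateWord, List.cons_prefix_cons, h.1, h.2]

theorem rotateWord_neg {d : ℕ} {i j : ZMod d} (h : i + j = 0) (v : List (ZMod d)) :
    rotateWord j (rotateWord i v) = v := by
  cases v <;> simp [rotateWord, add_assoc, h]

theorem spinalWord_length {d : ℕ} (c : ℕ → ZMod d) (v : List (ZMod d)) :
    (spinalWord c v).length = v.length := by
  induction v generalizing c with
  | nil => simp [spinalWord]
  | cons x v ih =>
    simp only [spinalWord]
    split_ifs <;> simp [rotateWord_length, ih]

theorem spinalWord_prefix {d : ℕ} (c : ℕ → ZMod d) {u v : List (ZMod d)} (h : u <+: v) :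
    spinalWord c u <+: spinalWord c v := by
  induction u generalizing c v with
  | nil => simp [spinalWord]
  | cons x u ih =>
    cases v with
    | nil => simp at h
    | cons y v =>
      rw [List.cons_prefix_cons] at h
      obtain ⟨rfl, h⟩ := h
      simp only [spinalWord]
      split_ifs
      · exact List.cons_prefix_cons.2 ⟨rfl, rotateWord_prefix _ h⟩
      · exact List.cons_prefix_cons.2 ⟨rfl, ih _ h⟩
      · exact List.cons_prefix_cons.2 ⟨rfl, h⟩

theorem spinalWord_neg {d : ℕ} {c c' : ℕ → ZMod d} (h : ∀ n, c n + c' n = 0)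
    (v : List (ZMod d)) : spinalWord c' (spinalWord c v) = v := by
  induction v generalizing c c' with
  | nil => simp [spinalWord]
  | cons x v ih =>
    by_cases h0 : x = 0
    · subst h0
      simp [spinalWord, rotateWord_neg (h 0)]
    · by_cases h1 : x = -1
      · subst h1
        simp only [spinalWord, if_neg h0, if_true]
        rw [ih fun n => h (n + 1)]
      · simp [spinalWord, h0, h1]

/-- The automorphism `a`: `a(v_0 v_1 … v_n) = (v_0 + 1) v_1 … v_n`. -/
def treeRotation (d : ℕ) : TreeAut (ZMod d) :=
  ⟨{ toFun := rotateWord 1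
     invFun := rotateWord (-1)
     left_inv := rotateWord_neg (by simp)
     right_inv := rotateWord_neg (by simp) },
   rotateWord_length 1, fun _ _ h => rotateWord_prefix 1 h⟩

/-- The spinal automorphism `b_ω` defined by `b ∈ B = (ℤ/dℤ)^m` and a sequence `ω` of homomorphisms
from `B` to `ℤ/dℤ`:
`b_ω((d-1)^r 0 v_{r+1} v_{r+2} … v_n) = (d-1)^r 0 (v_{r+1} + ω_r(b)) v_{r+2} … v_n`,
and all the other words are fixed. -/
def spinalAut {d m : ℕ} (ω : ℕ → ((Fin m → ZMod d) →+ ZMod d)) (b : Fin m → ZMod d) :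
    TreeAut (ZMod d) :=
  ⟨{ toFun := spinalWord fun n => ω n b
     invFun := spinalWord fun n => ω n (-b)
     left_inv := spinalWord_neg (by simp)
     right_inv := spinalWord_neg (by simp) },
   spinalWord_length _, fun _ _ h => spinalWord_prefix _ h⟩

/-- The set `Ω_{d,m}` of sequences of epimorphisms from `B = (ℤ/dℤ)^m` to `ℤ/dℤ` such that
`⋂_{j ≥ i} Ker ω_j` is trivial for all `i`. -/
def spinalSequences (d m : ℕ) : Set (ℕ → ((Fin m → ZMod d) →+ ZMod d)) :=
  {ω | (∀ n, Function.Surjective (ω n)) ∧ ∀ i, ⨅ j ≥ i, (ω j).ker = ⊥}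

/-- The subgroup `A = ⟨a⟩` of `Aut(T_d)`. -/
def rotationGroup (d : ℕ) : Subgroup (TreeAut (ZMod d)) := Subgroup.zpowers (treeRotation d)

/-- The subgroup `B_ω = ⟨b_ω | b ∈ B⟩` of `Aut(T_d)`. -/
def spinalPart {d m : ℕ} (ω : ℕ → ((Fin m → ZMod d) →+ ZMod d)) : Subgroup (TreeAut (ZMod d)) :=
  Subgroup.closure (Set.range (spinalAut ω))

/-- The spinal group `G_ω = ⟨A, B_ω⟩`. -/
def spinalGroup {d m : ℕ} (ω : ℕ → ((Fin m → ZMod d) →+ ZMod d)) : Subgroup (TreeAut (ZMod d)) :=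
  rotationGroup d ⊔ spinalPart ω

/-- The spinal generating set `S_ω = (A ∪ B_ω) \ {1}` of `G_ω`. -/
def spinalGenerators {d m : ℕ} (ω : ℕ → ((Fin m → ZMod d) →+ ZMod d)) : Set (spinalGroup ω) :=
  {g | ((g : TreeAut (ZMod d)) ∈ rotationGroup d ∨ (g : TreeAut (ZMod d)) ∈ spinalPart ω) ∧ g ≠ 1}

/-! ### Schreier graphs -/

/-- The orbital Schreier graph of the orbit of `y` for the action of `G`, with respect to the
generating set `S`, as an undirected, unlabeled multigraph. There is one edge for every vertex `v` of
the orbit and every `s ∈ S`; its ends are `v` and `s v`, and it is a loop if `s v = v`. -/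
def schreierGraph {G Y : Type*} [Group G] [MulAction G Y] (S : Set G) (y : Y) :
    Graph Y (Y × G) where
  vertexSet := MulAction.orbit G y
  IsLink e u v := (e.1 ∈ MulAction.orbit G y ∧ e.2 ∈ S) ∧ s(u, v) = s(e.1, e.2 • e.1)
  edgeSet := {e | e.1 ∈ MulAction.orbit G y ∧ e.2 ∈ S}
  isLink_symm e _ := ⟨fun u v h => ⟨h.1, Sym2.eq_swap.trans h.2⟩⟩
  eq_or_eq_of_isLink_of_isLink := by
    rintro e x y v w ⟨-, h1⟩ ⟨-, h2⟩
    have := h1.trans h2.symm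
    rw [Sym2.eq_iff] at this
    tauto
  edge_mem_iff_exists_isLink e := ⟨fun h => ⟨_, _, h, rfl⟩, fun ⟨_, _, h, _⟩ => h⟩
  left_mem_of_isLink := by
    rintro e u v ⟨⟨he, -⟩, h⟩
    rw [Sym2.eq_iff] at h
    obtain ⟨rfl, -⟩ | ⟨rfl, -⟩ := h
    · exact he
    · exact MulAction.mem_orbit_of_mem_orbit _ he

/-- The rooted multigraphs `(Γ, x)` and `(Δ, y)` are isomorphic: there are bijections between the
vertex sets and between the edge sets that respect the incidence relation (hence also the
multiplicities of edges and loops) and send the root `x` to the root `y`. -/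
def RootedIsomorphic {α β α' β' : Type*} (Γ : Graph α β) (x : α) (Δ : Graph α' β') (y : α') :
    Prop :=
  ∃ (hx : x ∈ Γ.vertexSet) (hy : y ∈ Δ.vertexSet) (φ : Γ.vertexSet ≃ Δ.vertexSet) (ψ : Γ.edgeSet ≃ Δ.edgeSet),
    φ ⟨x, hx⟩ = ⟨y, hy⟩ ∧
    ∀ (e : Γ.edgeSet) (u v : Γ.vertexSet), Γ.IsLink e u v ↔ Δ.IsLink (ψ e) (φ u) (φ v)

/-- The Schreier graph `Γ_ξ` of the spinal group `G_ω` on the orbit of the boundary point `ξ`, with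
respect to the spinal generating set, as an undirected, unlabeled multigraph. -/
def spinalSchreierGraph {d m : ℕ} (ω : ℕ → ((Fin m → ZMod d) →+ ZMod d)) (ξ : ℕ → ZMod d) :
    Graph (ℕ → ZMod d) ((ℕ → ZMod d) × spinalGroup ω) :=
  schreierGraph (spinalGenerators ω) ξ

/-- The class of the boundary point `ξ`: all boundary points `η` such that the rooted, undirected,
unlabeled graphs `(Γ_ξ, ξ)` and `(Γ_η, η)` are isomorphic. -/
def rootedIsomorphismClass {d m : ℕ} (ω : ℕ → ((Fin m → ZMod d) →+ ZMod d)) (ξ : ℕ → ZMod d) :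
    Set (ℕ → ZMod d) :=
  {η | RootedIsomorphic (spinalSchreierGraph ω ξ) ξ (spinalSchreierGraph ω η) η}

/-- The Bernoulli measure on `X^ℕ`: the product of the uniform probability measures on the alphabet
`X = {0, …, d - 1}`. -/
noncomputable def bernoulliMeasure (d : ℕ) [NeZero d] : MeasureTheory.Measure (ℕ → ZMod d) :=
  MeasureTheory.Measure.infinitePi fun _ : ℕ => (PMF.uniformOfFintype (ZMod d)).toMeasure

/-! ### The underlying simple graph on the boundary -/

/-! Forget loops and multiplicities: every rooted isomorphism still preserves the simple graph
`SpinalAdj`, in which a word lies in the clique of words with its tail and, if it begins with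
`(d-1)^r 0`, in a second clique where only the next letter varies. These cliques meet only in that
word, so a word is simplicial exactly when it has no such beginning (`isSimplicial_iff`). As `d ≥
3`, every clique of the first kind contains a simplicial word, one starting with `1`; hence having
equal tails is a graph property (`tailSeq_eq_iff`).

Contracting these cliques gives the same graph again, now on the tails
(`spinalAdj_iff_exists_spinAdj`), so an isomorphism descends to tails (`IsPartialIso.tail`), and by
iteration to all shifts. Consequently, for every `n`, the `n`-th shifts of `ξ` and `η` both begin
with some `(d-1)^r 0` or both do not. In the first case `η n ≠ 1`, in the second `η n ≠ 0`. So `η`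
avoids at each position a letter determined by `ξ`, which is a null event. -/

/-- The infinite word obtained by deleting the first letter. -/
def tailSeq {X : Type*} (v : ℕ → X) : ℕ → X := fun n => v (n + 1)

/-- The infinite word with first letter `x` and tail `v`. -/
def consSeq {X : Type*} (x : X) (v : ℕ → X) : ℕ → X
  | 0 => x
  | n + 1 => v n

@[simp] theorem consSeq_zero {X : Type*} (x : X) (v : ℕ → X) : consSeq x v 0 = x := rfl

theorem eq_of_head_tail {X : Type*} {v w : ℕ → X} (h0 : v 0 = w 0) (h : tailSeq v = tailSeq w) :
    v = w := by
  funext n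
  cases n with
  | zero => exact h0
  | succ n => exact congrFun h n

theorem tailSeq_iterate {X : Type*} (n : ℕ) (v : ℕ → X) (i : ℕ) :
    (tailSeq^[n] v) i = v (i + n) := by
  induction n generalizing v with
  | zero => rfl
  | succ n ih => rw [Function.iterate_succ_apply, ih]; rfl

theorem wordPrefix_succ {X : Type*} (v : ℕ → X) (n : ℕ) :
    wordPrefix v (n + 1) = v 0 :: wordPrefix (tailSeq v) n := by
  simp [wordPrefix, List.range_succ_eq_map, tailSeq, Function.comp_def]

/-- `v = (d-1)^r 0 v_{r+1} …`. -/
def HasSpine {d : ℕ} (r : ℕ) (v : ℕ → ZMod d) : Prop := (∀ i < r, v i = -1) ∧ v r = 0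

/-- The words `v` and `w` differ, but only in the letter that follows a prefix `(d-1)^r 0`. -/
def SpinAdj {d : ℕ} (v w : ℕ → ZMod d) : Prop :=
  v ≠ w ∧ ∃ r, HasSpine r v ∧ ∀ i, i ≠ r + 1 → v i = w i

/-- Adjacency in the underlying simple graph of the Schreier graphs of spinal groups. -/
def SpinalAdj {d : ℕ} (v w : ℕ → ZMod d) : Prop :=
  (v ≠ w ∧ tailSeq v = tailSeq w) ∨ SpinAdj v w

theorem HasSpine.congr {d : ℕ} {r : ℕ} {v w : ℕ → ZMod d} (h : HasSpine r v)
    (hvw : ∀ i, i ≠ r + 1 → v i = w i) : HasSpine r w :=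
  ⟨fun i hi => (hvw i (by omega)).symm.trans (h.1 i hi), (hvw r (by omega)).symm.trans h.2⟩

theorem HasSpine.unique {d : ℕ} (h01 : (-1 : ZMod d) ≠ 0) {r s : ℕ} {v : ℕ → ZMod d}
    (hr : HasSpine r v) (hs : HasSpine s v) : r = s := by
  rcases lt_trichotomy r s with h | h | h
  · exact absurd ((hs.1 r h).symm.trans hr.2) h01
  · exact h
  · exact absurd ((hr.1 s h).symm.trans hs.2) h01

theorem SpinAdj.symm {d : ℕ} {v w : ℕ → ZMod d} (h : SpinAdj v w) : SpinAdj w v := by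
  obtain ⟨hne, r, hr, hvw⟩ := h
  exact ⟨hne.symm, r, hr.congr hvw, fun i hi => (hvw i hi).symm⟩

theorem SpinAdj.head_eq {d : ℕ} {v w : ℕ → ZMod d} (h : SpinAdj v w) : v 0 = w 0 := by
  obtain ⟨-, r, -, hvw⟩ := h
  exact hvw 0 (by omega)

theorem SpinAdj.tail_ne {d : ℕ} {v w : ℕ → ZMod d} (h : SpinAdj v w) : tailSeq v ≠ tailSeq w :=
  fun ht => h.1 (eq_of_head_tail h.head_eq ht)

theorem SpinalAdj.symm {d : ℕ} {v w : ℕ → ZMod d} (h : SpinalAdj v w) : SpinalAdj w v := by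
  rcases h with h | h
  · exact Or.inl ⟨h.1.symm, h.2.symm⟩
  · exact Or.inr h.symm

theorem SpinalAdj.ne {d : ℕ} {v w : ℕ → ZMod d} (h : SpinalAdj v w) : v ≠ w := by
  rcases h with h | h <;> exact h.1

/-- The graph on the tails obtained by contracting the rotation edges is again the same graph. -/
theorem spinalAdj_iff_exists_spinAdj {d : ℕ} {v w : ℕ → ZMod d} :
    SpinalAdj v w ↔ ∃ x, SpinAdj (consSeq x v) (consSeq x w) := by
  constructor
  · rintro (⟨hne, ht⟩ | ⟨hne, r, hr, hvw⟩)
    -- Prefixing `0` puts the old first letter right after the spine; below, prefixing `-1`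
    -- lengthens the old spine by one.
    · refine ⟨0, fun h => hne (congrArg tailSeq h), 0, ⟨by simp, rfl⟩, ?_⟩
      rintro (_ | _ | i) hi
      · rfl
      · exact absurd rfl hi
      · exact congrFun ht i
    · refine ⟨-1, fun h => hne (congrArg tailSeq h), r + 1, ⟨?_, hr.2⟩, ?_⟩
      · rintro (_ | i) hi
        · rfl
        · exact hr.1 i (by omega)
      · rintro (_ | i) hi
        · rfl
        · exact hvw i (by omega)
  · rintro ⟨x, hne, r, hr, hvw⟩
    have hne' : v ≠ w := fun h => hne (by rw [h])
    rcases r with _ | r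
    · exact Or.inl ⟨hne', funext fun i => hvw (i + 2) (by omega)⟩
    · exact Or.inr ⟨hne', r, ⟨fun i hi => hr.1 (i + 1) (by omega), hr.2⟩,
        fun i hi => hvw (i + 1) (by omega)⟩

/-! ### Simplicial vertices -/

/-- The neighbours of `u` form a clique. -/
def IsSimplicial {d : ℕ} (u : ℕ → ZMod d) : Prop :=
  ∀ v w, SpinalAdj u v → SpinalAdj u w → v = w ∨ SpinalAdj v w

theorem exists_spinAdj_iff {d : ℕ} [Nontrivial (ZMod d)] {u : ℕ → ZMod d} :
    (∃ w, SpinAdj u w) ↔ ∃ r, HasSpine r u := by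
  constructor
  · rintro ⟨w, -, r, hr, -⟩
    exact ⟨r, hr⟩
  · rintro ⟨r, hr⟩
    refine ⟨Function.update u (r + 1) (u (r + 1) + 1), fun h => ?_, r, hr, fun i hi => ?_⟩
    · have := congrFun h (r + 1)
      simp at this
    · rw [Function.update_of_ne hi]

/-- A rotation neighbour and a spinal neighbour of `u` are never adjacent: they differ both in the
first letter and in the tail. Without a spine, only the rotation clique remains. -/
theorem isSimplicial_iff {d : ℕ} [Nontrivial (ZMod d)] {u : ℕ → ZMod d} :
    IsSimplicial u ↔ ¬ ∃ r, HasSpine r u := by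
  rw [← exists_spinAdj_iff]
  constructor
  · rintro h ⟨w, hw⟩
    have hx : u 0 + 1 ≠ u 0 := by simp
    have hadj : SpinalAdj u (consSeq (u 0 + 1) (tailSeq u)) :=
      Or.inl ⟨fun h => hx (congrFun h 0).symm, rfl⟩
    rcases h _ _ hadj (Or.inr hw) with h | h | h
    · exact hx ((congrFun h 0).trans hw.head_eq.symm)
    · exact hw.tail_ne h.2
    · exact hx (h.head_eq.trans hw.head_eq.symm)
  · rintro h v w (hv | hv) (hw | hw)
    · by_cases hvw : v = w
      · exact Or.inl hvw
      · exact Or.inr (Or.inl ⟨hvw, hv.2.symm.trans hw.2⟩)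
    · exact absurd ⟨w, hw⟩ h
    · exact absurd ⟨v, hv⟩ h
    · exact absurd ⟨v, hv⟩ h

/-- Words with the same tail are recognized by a common simplicial neighbour. -/
theorem tailSeq_eq_iff {d : ℕ} [Nontrivial (ZMod d)] (h2 : (1 : ZMod d) ≠ -1)
    {v w : ℕ → ZMod d} : tailSeq v = tailSeq w ↔
      ∃ u, IsSimplicial u ∧ (v = u ∨ SpinalAdj v u) ∧ (w = u ∨ SpinalAdj w u) := by
  constructor
  · intro h
    have key : ∀ x y : ℕ → ZMod d, tailSeq x = tailSeq y → x = y ∨ SpinalAdj x y := fun x y hxy => by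
      by_cases hne : x = y
      · exact Or.inl hne
      · exact Or.inr (Or.inl ⟨hne, hxy⟩)
    -- The letter `1` is neither `0` nor `-1`, so no word starting with it has a spine.
    refine ⟨consSeq 1 (tailSeq v), isSimplicial_iff.2 ?_, key _ _ rfl, key _ _ h.symm⟩
    rintro ⟨_ | r, hr⟩
    · exact one_ne_zero hr.2
    · exact h2 (hr.1 0 (by omega))
  · rintro ⟨u, hu, hv, hw⟩
    rw [isSimplicial_iff, ← exists_spinAdj_iff] at hu
    have key : ∀ x : ℕ → ZMod d, x = u ∨ SpinalAdj x u → tailSeq x = tailSeq u := by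
      rintro x (h | h | h)
      · rw [h]
      · exact h.2
      · exact absurd ⟨x, h.symm⟩ hu
    exact (key v hv).trans (key w hw).symm

/-! ### Partial isomorphisms and their descent to tails -/

/-- The relation `R` is an isomorphism between two unions of connected components of the graph
`SpinalAdj`. -/
structure IsPartialIso {d : ℕ} (R : (ℕ → ZMod d) → (ℕ → ZMod d) → Prop) : Prop where
  eq_iff : ∀ {v v' w w'}, R v v' → R w w' → (v = w ↔ v' = w')
  adj_iff : ∀ {v v' w w'}, R v v' → R w w' → (SpinalAdj v w ↔ SpinalAdj v' w')
  forth : ∀ {v v' w}, R v v' → SpinalAdj v w → ∃ w', R w w'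
  back : ∀ {v v' w'}, R v v' → SpinalAdj v' w' → ∃ w, R w w'

namespace IsPartialIso

variable {d : ℕ} {R : (ℕ → ZMod d) → (ℕ → ZMod d) → Prop}

/-- Lets each later transfer statement be proved in one direction only. -/
theorem flip (h : IsPartialIso R) : IsPartialIso (fun v w => R w v) where
  eq_iff h1 h2 := (h.eq_iff h1 h2).symm
  adj_iff h1 h2 := (h.adj_iff h1 h2).symm
  forth := h.back
  back := h.forth

theorem isSimplicial (h : IsPartialIso R) {u u' : ℕ → ZMod d} (hu : R u u')
    (hs : IsSimplicial u) : IsSimplicial u' := by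
  intro v' w' hv' hw'
  obtain ⟨v, hv⟩ := h.back hu hv'
  obtain ⟨w, hw⟩ := h.back hu hw'
  rw [← h.eq_iff hv hw, ← h.adj_iff hv hw]
  exact hs v w ((h.adj_iff hu hv).2 hv') ((h.adj_iff hu hw).2 hw')

theorem exists_hasSpine_iff [Nontrivial (ZMod d)] (h : IsPartialIso R) {u u' : ℕ → ZMod d}
    (hu : R u u') : (∃ r, HasSpine r u) ↔ ∃ r, HasSpine r u' := by
  rw [← not_iff_not, ← isSimplicial_iff, ← isSimplicial_iff]
  exact ⟨h.isSimplicial hu, h.flip.isSimplicial hu⟩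

theorem exists_of_eq_or_adj (h : IsPartialIso R) {v v' w : ℕ → ZMod d} (hv : R v v')
    (hw : v = w ∨ SpinalAdj v w) : ∃ w', R w w' ∧ (v' = w' ∨ SpinalAdj v' w') := by
  rcases hw with rfl | hw
  · exact ⟨v', hv, Or.inl rfl⟩
  · obtain ⟨w', hw'⟩ := h.forth hv hw
    exact ⟨w', hw', Or.inr ((h.adj_iff hv hw').1 hw)⟩

theorem tailSeq_eq [Nontrivial (ZMod d)] (h2 : (1 : ZMod d) ≠ -1) (h : IsPartialIso R)
    {v v' w w' : ℕ → ZMod d} (hv : R v v') (hw : R w w') (ht : tailSeq v = tailSeq w) :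
    tailSeq v' = tailSeq w' := by
  obtain ⟨u, hu, h3, h4⟩ := (tailSeq_eq_iff h2).1 ht
  obtain ⟨u', hu', h5⟩ := h.exists_of_eq_or_adj hv h3
  refine (tailSeq_eq_iff h2).2 ⟨u', h.isSimplicial hu' hu, h5, ?_⟩
  rwa [← h.eq_iff hw hu', ← h.adj_iff hw hu']

theorem exists_of_tailSeq_eq (h : IsPartialIso R) {v v' w : ℕ → ZMod d} (hv : R v v')
    (ht : tailSeq v = tailSeq w) : ∃ w', R w w' := by
  by_cases hvw : v = w
  · exact ⟨v', hvw ▸ hv⟩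
  · exact h.forth hv (Or.inl ⟨hvw, ht⟩)

/-- An edge between tails lifts to a spinal edge, which `R` carries to an edge of the image; that
edge still changes the tail, so it projects to an edge again. -/
theorem tail_adj [Nontrivial (ZMod d)] (h2 : (1 : ZMod d) ≠ -1) (h : IsPartialIso R)
    {v v' w : ℕ → ZMod d} (hv : R v v') (ha : SpinalAdj (tailSeq v) w) :
    ∃ w₁ w', R w₁ w' ∧ tailSeq w₁ = w ∧ SpinalAdj (tailSeq v') (tailSeq w') := by
  obtain ⟨x, hx⟩ := spinalAdj_iff_exists_spinAdj.1 ha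
  obtain ⟨y, hy⟩ := h.exists_of_tailSeq_eq (w := consSeq x (tailSeq v)) hv rfl
  obtain ⟨w', hw'⟩ := h.forth hy (Or.inr hx)
  have hyw : SpinalAdj y w' := (h.adj_iff hy hw').1 (Or.inr hx)
  have hne : tailSeq y ≠ tailSeq w' := fun ht => hx.tail_ne (h.flip.tailSeq_eq h2 hy hw' ht)
  refine ⟨_, w', hw', rfl, ?_⟩
  rw [h.tailSeq_eq h2 hv hy rfl]
  -- The image edge cannot be a rotation edge, since the tails of its ends differ.
  rcases hyw with hyw | hyw
  · exact absurd hyw.2 hne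
  · refine spinalAdj_iff_exists_spinAdj.2 ⟨y 0, ?_⟩
    rwa [show consSeq (y 0) (tailSeq y) = y from eq_of_head_tail rfl rfl,
      show consSeq (y 0) (tailSeq w') = w' from eq_of_head_tail hyw.head_eq rfl]

theorem tail [Nontrivial (ZMod d)] (h2 : (1 : ZMod d) ≠ -1) (h : IsPartialIso R) :
    IsPartialIso (fun x y => ∃ v w, R v w ∧ tailSeq v = x ∧ tailSeq w = y) where
  eq_iff := by
    rintro _ _ _ _ ⟨v, v', hv, rfl, rfl⟩ ⟨w, w', hw, rfl, rfl⟩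
    exact ⟨h.tailSeq_eq h2 hv hw, h.flip.tailSeq_eq h2 hv hw⟩
  adj_iff := by
    rintro _ _ _ _ ⟨v, v', hv, rfl, rfl⟩ ⟨w, w', hw, rfl, rfl⟩
    constructor
    · intro ha
      obtain ⟨w₁, w₁', hw₁, ht, ha'⟩ := h.tail_adj h2 hv ha
      rwa [h.tailSeq_eq h2 hw hw₁ ht.symm]
    · intro ha
      obtain ⟨w₁', w₁, hw₁, ht, ha'⟩ := h.flip.tail_adj h2 hv ha
      rwa [h.flip.tailSeq_eq h2 hw hw₁ ht.symm]
  forth := by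
    rintro _ _ w ⟨v, v', hv, rfl, rfl⟩ ha
    obtain ⟨w₁, w', hw, ht, -⟩ := h.tail_adj h2 hv ha
    exact ⟨_, w₁, w', hw, ht, rfl⟩
  back := by
    rintro _ _ w ⟨v, v', hv, rfl, rfl⟩ ha
    obtain ⟨w₁, w', hw, ht, -⟩ := h.flip.tail_adj h2 hv ha
    exact ⟨_, w', w₁, hw, rfl, ht⟩

/-- The induction varies `R`, replacing it at each step by the relation it induces on tails. -/
theorem exists_hasSpine_iterate_iff [Nontrivial (ZMod d)] (h2 : (1 : ZMod d) ≠ -1)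
    (h : IsPartialIso R) {u u' : ℕ → ZMod d} (hu : R u u') (n : ℕ) :
    (∃ r, HasSpine r (tailSeq^[n] u)) ↔ ∃ r, HasSpine r (tailSeq^[n] u') := by
  induction n generalizing R u u' with
  | zero => exact h.exists_hasSpine_iff hu
  | succ n ih =>
    rw [Function.iterate_succ_apply, Function.iterate_succ_apply]
    exact ih (h.tail h2) ⟨u, u', hu, rfl, rfl⟩

end IsPartialIso

/-! ### The action of the generators -/

theorem smul_eq_of_wordPrefix {X : Type*} {g : TreeAut X} {v w : ℕ → X}
    (h : ∀ n, g.1 (wordPrefix v n) = wordPrefix w n) : g • v = w :=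
  wordPrefix_injective fun n => (wordPrefix_boundaryMap g v n).trans (h n)

theorem treeRotation_smul {d : ℕ} (v : ℕ → ZMod d) :
    treeRotation d • v = consSeq (v 0 + 1) (tailSeq v) := by
  refine smul_eq_of_wordPrefix fun n => ?_
  cases n with
  | zero => rfl
  | succ n => rw [wordPrefix_succ, wordPrefix_succ]; rfl

theorem treeRotation_pow_smul {d : ℕ} (k : ℕ) (v : ℕ → ZMod d) :
    treeRotation d ^ k • v = consSeq (v 0 + k) (tailSeq v) := by
  induction k with
  | zero => rw [pow_zero, one_smul]; exact eq_of_head_tail (by simp) rfl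
  | succ k ih =>
    rw [pow_succ', mul_smul, ih, treeRotation_smul]
    exact eq_of_head_tail (by simp [add_assoc]) rfl

theorem tailSeq_rotationGroup_smul {d : ℕ} {g : TreeAut (ZMod d)} (hg : g ∈ rotationGroup d)
    (v : ℕ → ZMod d) : tailSeq (g • v) = tailSeq v := by
  rw [rotationGroup, Subgroup.zpowers_eq_closure] at hg
  induction hg using Subgroup.closure_induction generalizing v with
  | mem x hx => rw [Set.mem_singleton_iff.1 hx, treeRotation_smul]; rfl
  | one => rw [one_smul]
  | mul x y _ _ hx hy => rw [mul_smul, hx, hy]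
  | inv x _ hx => rw [← hx (x⁻¹ • v), smul_inv_smul]

theorem spinalWord_wordPrefix {d : ℕ} (h01 : (-1 : ZMod d) ≠ 0) {r : ℕ} {v : ℕ → ZMod d}
    (hr : HasSpine r v) (c : ℕ → ZMod d) (n : ℕ) :
    spinalWord c (wordPrefix v n) =
      wordPrefix (Function.update v (r + 1) (v (r + 1) + c r)) n := by
  induction r generalizing v c n with
  | zero =>
    rcases n with _ | _ | n
    · rfl
    · simp [spinalWord, hr.2, rotateWord, wordPrefix]
    · have ht : tailSeq (tailSeq (Function.update v 1 (v 1 + c 0))) = tailSeq (tailSeq v) := by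
        funext i
        simp [tailSeq]
      simp [wordPrefix_succ, spinalWord, hr.2, rotateWord, ht]
      simp [tailSeq]
  | succ r ih =>
    cases n with
    | zero => rfl
    | succ n =>
      have h0 : v 0 = -1 := hr.1 0 (by omega)
      have hr' : HasSpine r (tailSeq v) := ⟨fun i hi => hr.1 (i + 1) (by omega), hr.2⟩
      have ht : tailSeq (Function.update v (r + 1 + 1) (v (r + 1 + 1) + c (r + 1))) =
          Function.update (tailSeq v) (r + 1) (tailSeq v (r + 1) + c (r + 1)) := by
        funext i
        simp [tailSeq, Function.update_apply]
      rw [wordPrefix_succ, wordPrefix_succ, ht, ← ih hr' (fun n => c (n + 1))]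
      simp [spinalWord, h0, h01]

theorem spinalWord_wordPrefix_of_not {d : ℕ} {v : ℕ → ZMod d}
    (hv : ¬ ∃ r, HasSpine r v) (c : ℕ → ZMod d) (n : ℕ) :
    spinalWord c (wordPrefix v n) = wordPrefix v n := by
  induction n generalizing v c with
  | zero => rfl
  | succ n ih =>
    have h0 : v 0 ≠ 0 := fun h => hv ⟨0, by simp, h⟩
    by_cases h1 : v 0 = -1
    · have ht : ¬ ∃ r, HasSpine r (tailSeq v) := by
        rintro ⟨r, hr⟩
        refine hv ⟨r + 1, ?_, hr.2⟩
        rintro (_ | i) hi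
        · exact h1
        · exact hr.1 i (by omega)
      rw [wordPrefix_succ, spinalWord, if_neg h0, if_pos h1, ih ht]
    · rw [wordPrefix_succ, spinalWord, if_neg h0, if_neg h1]

theorem spinalAut_smul {d m : ℕ} (h01 : (-1 : ZMod d) ≠ 0)
    (ω : ℕ → ((Fin m → ZMod d) →+ ZMod d)) (b : Fin m → ZMod d) {r : ℕ} {v : ℕ → ZMod d}
    (hr : HasSpine r v) :
    spinalAut ω b • v = Function.update v (r + 1) (v (r + 1) + ω r b) :=
  smul_eq_of_wordPrefix fun n => spinalWord_wordPrefix h01 hr _ n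

theorem spinalAut_smul_of_not {d m : ℕ} (ω : ℕ → ((Fin m → ZMod d) →+ ZMod d))
    (b : Fin m → ZMod d) {v : ℕ → ZMod d} (hv : ¬ ∃ r, HasSpine r v) : spinalAut ω b • v = v :=
  smul_eq_of_wordPrefix fun n => spinalWord_wordPrefix_of_not hv _ n

/-- The spine of a word is unique and unchanged by a spinal move, so successive moves alter the same
letter. -/
theorem SpinAdj.trans {d : ℕ} (h01 : (-1 : ZMod d) ≠ 0) {u v w : ℕ → ZMod d}
    (h : v = u ∨ SpinAdj u v) (h' : w = v ∨ SpinAdj v w) : w = u ∨ SpinAdj u w := by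
  by_cases huw : w = u
  · exact Or.inl huw
  rcases h with rfl | h
  · exact h'
  rcases h' with rfl | h'
  · exact Or.inr h
  obtain ⟨-, r, hr, huv⟩ := h
  obtain ⟨-, s, hs, hvw⟩ := h'
  obtain rfl := (hr.congr huv).unique h01 hs
  exact Or.inr ⟨Ne.symm huw, r, hr, fun i hi => (huv i hi).trans (hvw i hi)⟩

theorem spinalPart_smul {d m : ℕ} (h01 : (-1 : ZMod d) ≠ 0)
    {ω : ℕ → ((Fin m → ZMod d) →+ ZMod d)} {g : TreeAut (ZMod d)} (hg : g ∈ spinalPart ω)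
    (v : ℕ → ZMod d) : g • v = v ∨ SpinAdj v (g • v) := by
  induction hg using Subgroup.closure_induction generalizing v with
  | mem x hx =>
    obtain ⟨b, rfl⟩ := hx
    by_cases hv : ∃ r, HasSpine r v
    · obtain ⟨r, hr⟩ := hv
      by_cases hne : spinalAut ω b • v = v
      · exact Or.inl hne
      · refine Or.inr ⟨Ne.symm hne, r, hr, fun i hi => ?_⟩
        rw [spinalAut_smul h01 ω b hr, Function.update_of_ne hi]
    · exact Or.inl (spinalAut_smul_of_not ω b hv)
  | one => exact Or.inl (one_smul _ v)
  | mul x y _ _ hx hy => rw [mul_smul]; exact SpinAdj.trans h01 (hy v) (hx _)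
  | inv x _ hx =>
    rcases hx (x⁻¹ • v) with h | h
    · rw [smul_inv_smul] at h
      exact Or.inl h.symm
    · rw [smul_inv_smul] at h
      exact Or.inr h.symm

theorem spinalAdj_smul {d m : ℕ} (h01 : (-1 : ZMod d) ≠ 0)
    {ω : ℕ → ((Fin m → ZMod d) →+ ZMod d)} {g : spinalGroup ω} (hg : g ∈ spinalGenerators ω)
    {v : ℕ → ZMod d} (hv : v ≠ g • v) : SpinalAdj v (g • v) := by
  rcases hg.1 with h | h
  · exact Or.inl ⟨hv, (tailSeq_rotationGroup_smul h v).symm⟩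
  · rcases spinalPart_smul h01 h v with h | h
    · exact absurd h.symm hv
    · exact Or.inr h

/-- Surjectivity of `ω r` realizes every change of the letter after the spine, so the simple graph
does not depend on `ω`. -/
theorem SpinalAdj.exists_smul {d m : ℕ} [NeZero d] (h01 : (-1 : ZMod d) ≠ 0)
    {ω : ℕ → ((Fin m → ZMod d) →+ ZMod d)} (hω : ∀ n, Function.Surjective (ω n))
    {v w : ℕ → ZMod d} (h : SpinalAdj v w) : ∃ g ∈ spinalGenerators ω, g • v = w := by
  have key : ∀ g : TreeAut (ZMod d), g ∈ rotationGroup d ∨ g ∈ spinalPart ω → g • v = w →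
      ∃ g ∈ spinalGenerators ω, g • v = w := by
    intro g hg hgv
    have hgG : g ∈ spinalGroup ω := hg.elim (fun h => (le_sup_left : _ ≤ spinalGroup ω) h)
      fun h => (le_sup_right : _ ≤ spinalGroup ω) h
    refine ⟨⟨g, hgG⟩, ⟨hg, fun h1 => h.ne ?_⟩, hgv⟩
    rw [← hgv, show g = 1 from congrArg Subtype.val h1, one_smul]
  rcases h with ⟨-, ht⟩ | ⟨-, r, hr, hvw⟩
  · refine key (treeRotation d ^ (w 0 - v 0).val)
      (Or.inl (Subgroup.pow_mem _ (Subgroup.mem_zpowers _) _)) ?_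
    rw [treeRotation_pow_smul]
    exact eq_of_head_tail (by simp) ht
  · obtain ⟨b, hb⟩ := hω r (w (r + 1) - v (r + 1))
    refine key (spinalAut ω b) (Or.inr (Subgroup.subset_closure ⟨b, rfl⟩)) ?_
    rw [spinalAut_smul h01 ω b hr, hb]
    funext i
    by_cases hi : i = r + 1
    · subst hi; simp
    · rw [Function.update_of_ne hi, hvw i hi]

/-! ### From multigraph isomorphisms to the simple graph -/

theorem spinalAdj_iff_isLink {d m : ℕ} [NeZero d] (h01 : (-1 : ZMod d) ≠ 0)
    {ω : ℕ → ((Fin m → ZMod d) →+ ZMod d)} (hω : ∀ n, Function.Surjective (ω n))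
    {ξ v w : ℕ → ZMod d} (hv : v ∈ (spinalSchreierGraph ω ξ).vertexSet) :
    SpinalAdj v w ↔ v ≠ w ∧ ∃ e, (spinalSchreierGraph ω ξ).IsLink e v w := by
  constructor
  · intro h
    obtain ⟨g, hg, rfl⟩ := h.exists_smul h01 hω
    exact ⟨h.ne, (v, g), ⟨hv, hg⟩, rfl⟩
  · rintro ⟨hne, ⟨x, g⟩, ⟨-, hg⟩, h⟩
    rw [Sym2.eq_iff] at h
    obtain ⟨rfl, rfl⟩ | ⟨rfl, rfl⟩ := h
    · exact spinalAdj_smul h01 hg hne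
    · exact (spinalAdj_smul h01 hg hne.symm).symm

theorem RootedIsomorphic.exists_isPartialIso {d m : ℕ} [NeZero d] (h01 : (-1 : ZMod d) ≠ 0)
    {ω : ℕ → ((Fin m → ZMod d) →+ ZMod d)} (hω : ∀ n, Function.Surjective (ω n))
    {ξ η : ℕ → ZMod d}
    (h : RootedIsomorphic (spinalSchreierGraph ω ξ) ξ (spinalSchreierGraph ω η) η) :
    ∃ R : (ℕ → ZMod d) → (ℕ → ZMod d) → Prop, IsPartialIso R ∧ R ξ η := by
  obtain ⟨hx, hy, φ, ψ, hφ, hψ⟩ := h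
  have mem : ∀ {ζ v w : ℕ → ZMod d}, v ∈ (spinalSchreierGraph ω ζ).vertexSet → SpinalAdj v w →
      w ∈ (spinalSchreierGraph ω ζ).vertexSet := fun hv ha => by
    obtain ⟨-, e, he⟩ := (spinalAdj_iff_isLink h01 hω hv).1 ha
    exact he.right_mem
  refine ⟨fun v w => ∃ hv, (φ ⟨v, hv⟩ : ℕ → ZMod d) = w, ⟨?_, ?_, ?_, ?_⟩, hx, by rw [hφ]⟩
  · rintro v _ w _ ⟨hv, rfl⟩ ⟨hw, rfl⟩
    simp [Subtype.coe_inj]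
  · rintro v _ w _ ⟨hv, rfl⟩ ⟨hw, rfl⟩
    rw [spinalAdj_iff_isLink h01 hω hv, spinalAdj_iff_isLink h01 hω (φ ⟨v, hv⟩).2]
    refine and_congr (by simp [Subtype.coe_inj]) ⟨?_, ?_⟩
    · rintro ⟨e, he⟩
      exact ⟨_, (hψ ⟨e, he.edge_mem⟩ ⟨v, hv⟩ ⟨w, hw⟩).1 he⟩
    · rintro ⟨e, he⟩
      refine ⟨_, (hψ (ψ.symm ⟨e, he.edge_mem⟩) ⟨v, hv⟩ ⟨w, hw⟩).2 ?_⟩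
      rwa [Equiv.apply_symm_apply]
  · rintro v _ w ⟨hv, rfl⟩ ha
    exact ⟨_, mem hv ha, rfl⟩
  · rintro v _ w ⟨hv, rfl⟩ ha
    refine ⟨φ.symm ⟨w, mem (φ ⟨v, hv⟩).2 ha⟩, Subtype.prop _, ?_⟩
    rw [Subtype.coe_eta, Equiv.apply_symm_apply]

/-! ### The measure of the classes -/

/-- Avoiding the prescribed letters in the first `N` positions has probability `(1 - 1/d)^N`, which
tends to `0`. -/
theorem bernoulliMeasure_forall_ne (d : ℕ) [NeZero d] (x : ℕ → ZMod d) :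
    bernoulliMeasure d {η | ∀ n, η n ≠ x n} = 0 := by
  have hq : ∀ y : ZMod d, (PMF.uniformOfFintype (ZMod d)).toMeasure {y}ᶜ = 1 - (d : ENNReal)⁻¹ := by
    intro y
    rw [MeasureTheory.prob_compl_eq_one_sub (MeasurableSet.singleton y),
      PMF.toMeasure_apply_singleton _ _ (MeasurableSet.singleton y), PMF.uniformOfFintype_apply,
      ZMod.card]
  have hlt : 1 - (d : ENNReal)⁻¹ < 1 :=
    ENNReal.sub_lt_self ENNReal.one_ne_top one_ne_zero
      (ENNReal.inv_ne_zero.2 (ENNReal.natCast_ne_top d))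
  refine le_antisymm (ge_of_tendsto' (ENNReal.tendsto_pow_atTop_nhds_zero_of_lt_one hlt)
    fun N => ?_) zero_le
  have hsub : {η : ℕ → ZMod d | ∀ n, η n ≠ x n} ⊆
      Set.pi (Finset.range N : Set ℕ) fun n => {x n}ᶜ := fun η hη n _ => hη n
  refine (MeasureTheory.measure_mono hsub).trans ?_
  rw [bernoulliMeasure, MeasureTheory.Measure.infinitePi_pi _
    fun n _ => (MeasurableSet.singleton (x n)).compl]
  simp [hq]

theorem mainTheorem5 (d m : ℕ) [NeZero d] (hd : 3 ≤ d) (hm : 1 ≤ m)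
    (ω : ℕ → ((Fin m → ZMod d) →+ ZMod d)) (hω : ω ∈ spinalSequences d m) (ξ : ℕ → ZMod d) :
    bernoulliMeasure d (rootedIsomorphismClass ω ξ) = 0 := by
  classical
  have : Fact (1 < d) := ⟨by omega⟩
  have : Fact (2 < d) := ⟨by omega⟩
  have h2 : (1 : ZMod d) ≠ -1 := (ZMod.neg_one_ne_one (n := d)).symm
  have h01 : (-1 : ZMod d) ≠ 0 := neg_ne_zero.2 one_ne_zero
  -- The letter that `η` must avoid at position `n` is `1` if the `n`-th shift of `ξ` has a spine,
  -- and `0` otherwise.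
  refine MeasureTheory.measure_mono_null ?_ (bernoulliMeasure_forall_ne d
    fun n => if ∃ r, HasSpine r (tailSeq^[n] ξ) then 1 else 0)
  intro η hη n
  obtain ⟨R, hR, hRξ⟩ := RootedIsomorphic.exists_isPartialIso h01 hω.1 hη
  have hiff := hR.exists_hasSpine_iterate_iff h2 hRξ n
  have h0 : (tailSeq^[n] η) 0 = η n := by rw [tailSeq_iterate, zero_add]
  simp only [hiff]
  -- A word with a spine starts with `0` or `-1`, hence not with `1`; a word starting with `0` has a
  -- spine with `r = 0`.
  split_ifs with h
  · obtain ⟨_ | r, hr⟩ := h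
    · rw [← h0, hr.2]
      exact zero_ne_one
    · rw [← h0, hr.1 0 (by omega)]
      exact h2.symm
  · exact fun h1 => h ⟨0, by simp, h0.trans h1⟩
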